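/- Assume $\mathfrak b=\mathfrak c$, where $\mathfrak b$ is the bounding number (the least cardinality of a family $A\subseteq{}^\omega\omega$ such that no $g\in{}^\omega\omega$ satisfies: for every $f\in A$, $f(n)\le g(n)$ for all but finitely many $n$) and $\mathfrak c$ is the cardinality of the continuum. A free ultrafilter $u$ on $\omega$ is a P-point if for every partition $(V_n)_{n<\omega}$ of $\omega$ there is $U\in u$ such that either $U\subseteq V_n$ for some $n$, or $U\cap V_n$ is finite for all $n$. For filters on $\omega$ write $\mathcal G\le_{RK}\mathcal F$ if there is $h:\omega\to\omega$ with $h^{-1}(G)\in\mathcal F$ for all $G\in\mathcal G$, and $\mathcal G<_{RK}\mathcal F$ if $\mathcal G\le_{RK}\mathcal F$ and $\mathcal F\not\le_{RK}\mathcal G$. Then for every ordinal $\gamma$ with $0<\gamma<\mathfrak b^{+}$ and every P-point $p$ there is a family $(p_\alpha)$ of P-points, indexed by those ordinals $\alpha<\gamma$ that are $0$ or a successor ordinal, such that $p_0=p$ and $p_\alpha<_{RK}p_\beta$ whenever $\alpha<\beta$ are two such indices. -/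

import Mathlib

open Filter Cardinal

/-- A (free) ultrafilter on `ω` is a P-point if for each partition `(V n)` of `ω` (blocks may be
empty) it has an element that is contained in one block or meets every block in a finite set. -/
def IsPPoint (u : Ultrafilter ℕ) : Prop :=
  (u : Filter ℕ) ≤ cofinite ∧
    ∀ V : ℕ → Set ℕ, Pairwise (Function.onFun Disjoint V) → (⋃ n, V n) = Set.univ →
      ∃ U ∈ u, (∃ n, U ⊆ V n) ∨ ∀ n, (U ∩ V n).Finite

/-- `RKLE G F`: the filter `F` is RK-greater than (or equivalent to) the filter `G`. -/
def RKLE (G F : Filter ℕ) : Prop :=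
  ∃ h : ℕ → ℕ, ∀ s ∈ G, h ⁻¹' s ∈ F

/-- The strict Rudin–Keisler order. -/
def RKLT (G F : Filter ℕ) : Prop :=
  RKLE G F ∧ ¬ RKLE F G

/-- A family of functions `ω → ω` is unbounded if no single function dominates all its members,
where `g` dominates `f` if `f n ≤ g n` for all but finitely many `n`. -/
def IsUnboundedFamily (A : Set (ℕ → ℕ)) : Prop :=
  ¬ ∃ g : ℕ → ℕ, ∀ f ∈ A, ∀ᶠ n in cofinite, f n ≤ g n

/-- The bounding number `𝔟`. -/
noncomputable def boundingNumber : Cardinal.{0} :=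
  sInf {κ | ∃ A : Set (ℕ → ℕ), IsUnboundedFamily A ∧ #A = κ}

/-- The class consisting of `0` and the successor ordinals. -/
def IsZeroOrSucc (α : Ordinal.{0}) : Prop :=
  α = 0 ∨ ∃ δ : Ordinal.{0}, α = Order.succ δ

/-! All the new P-points are images of a single P-point `q` on pairs `(n, x)`, `x < n ^ n`, whose
first projection is `p`. For `φ` below the identity, reducing `x` modulo `n ^ φ n` gives an image of
`q`, and a larger exponent gives a finer reduction, hence an RK-larger image. By
`exists_farBelow_chain`, exponents increasing modulo finite exist along any ordinal of cardinality
at most `𝔟`.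

Strictness: an ultrafilter maps into itself only by a function that is the identity on one of its
elements, so an RK-equivalence would make the finer residue a function of the coarser one on some `A
∈ q`. Then `A` meets almost every block in at most `n ^ (n - 1)` points. So `q` is built
(`exists_isPPoint_forall_isLargeAlong`) with all its elements exceeding every multiple of `n ^ (n -
1)` on `p`-almost every block; the recursion has length `𝔠 = 𝔟`, so each stage meets fewer than `𝔟`
earlier sets and can diagonalise. -/

/-- Transfinite construction of a function `u` whose value at every `i` stands in a relation `R` to
the values at the predecessors of `i`. -/
theorem exists_forall_rel_of_wellFounded {I X : Type*} [Nonempty X] {r : I → I → Prop}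
    (hr : WellFounded r) (R : I → (I → X) → X → Prop)
    (hlocal : ∀ i u v x, (∀ j, r j i → u j = v j) → R i u x → R i v x)
    (hstep : ∀ i u, (∀ j, r j i → R j u (u j)) → ∃ x, R i u x) :
    ∃ u : I → X, ∀ i, R i u (u i) := by
  classical
  obtain ⟨d⟩ := ‹Nonempty X›
  let F : (i : I) → ((j : I) → r j i → X) → X := fun i v =>
    @Classical.epsilon X ⟨d⟩ (R i fun j => if h : r j i then v j h else d)
  let u : I → X := hr.fix F
  have hu : ∀ i, u i = @Classical.epsilon X ⟨d⟩ (R i fun j => if r j i then u j else d) := by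
    intro i
    have : u i = F i fun j _ => u j := hr.fix_eq F i
    simpa [F] using this
  refine ⟨u, fun i => ?_⟩
  induction i using hr.induction with
  | _ i ih =>
    obtain ⟨x, hx⟩ := hstep i u ih
    have hex : ∃ x, R i (fun j => if r j i then u j else d) x :=
      ⟨x, hlocal i u _ x (fun j hj => by simp [hj]) hx⟩
    have hspec := @Classical.epsilon_spec_aux X ⟨d⟩ _ hex
    rw [← hu i] at hspec
    exact hlocal i _ u _ (fun j hj => by simp [hj]) hspec

/-! ### Domination below `𝔟` and chains of exponents -/

/-- Fewer than `𝔟` functions are dominated by a single one. -/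
theorem exists_dominating {ι : Type} (hι : #ι < boundingNumber) (f : ι → ℕ → ℕ) :
    ∃ g : ℕ → ℕ, ∀ i, ∀ᶠ n in atTop, f i n ≤ g n := by
  by_contra hcon
  have hunb : IsUnboundedFamily (Set.range f) := by
    rintro ⟨g, hg⟩
    refine hcon ⟨g, fun i => ?_⟩
    have := hg (f i) ⟨i, rfl⟩
    rwa [Nat.cofinite_eq_atTop] at this
  have hle : boundingNumber ≤ #(Set.range f) := csInf_le' ⟨_, hunb, rfl⟩
  exact absurd (hle.trans mk_range_le) (not_le.2 hι)

/-- Below fewer than `𝔟` functions tending to infinity there is a function tending to infinity. -/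
theorem exists_tendsto_atTop_le {ι : Type} (hι : #ι < boundingNumber) (d : ι → ℕ → ℕ)
    (hd : ∀ i, Tendsto (d i) atTop atTop) :
    ∃ g : ℕ → ℕ, Tendsto g atTop atTop ∧ ∀ i, ∀ᶠ n in atTop, g n ≤ d i n := by
  have hm : ∀ i k, ∃ m, ∀ n ≥ m, k ≤ d i n := fun i k =>
    eventually_atTop.1 ((hd i).eventually_ge_atTop k)
  choose m hm using hm
  obtain ⟨M, hM⟩ := exists_dominating hι m
  -- `g` is a slow inverse of the dominating function `M`.
  let g : ℕ → ℕ := fun n => Nat.findGreatest (fun k => M k ≤ n) n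
  have hg : Tendsto g atTop atTop := by
    refine tendsto_atTop.2 fun k => ?_
    filter_upwards [eventually_ge_atTop k, eventually_ge_atTop (M k)] with n hn hn'
    exact Nat.le_findGreatest hn hn'
  refine ⟨g, hg, fun i => ?_⟩
  filter_upwards [hg.eventually (hM i), hg.eventually_gt_atTop 0] with n hn hpos
  have : M (g n) ≤ n := Nat.findGreatest_of_ne_zero (P := fun k => M k ≤ n) rfl hpos.ne'
  exact hm i (g n) n (hn.trans this)

/-- `g n - f n` tends to infinity (with truncated subtraction, so that `f n < g n` eventually). -/
def FarBelow (f g : ℕ → ℕ) : Prop :=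
  Tendsto (fun n => g n - f n) atTop atTop

theorem FarBelow.eventually_lt {f g : ℕ → ℕ} (h : FarBelow f g) : ∀ᶠ n in atTop, f n < g n := by
  filter_upwards [Tendsto.eventually_gt_atTop h 0] with n hn
  omega

theorem FarBelow.trans {f g h : ℕ → ℕ} (hfg : FarBelow f g) (hgh : FarBelow g h) :
    FarBelow f h := by
  refine tendsto_atTop_mono' atTop ?_ hgh
  filter_upwards [hfg.eventually_lt] with n hn
  omega

/-- Fewer than `𝔟` functions far below `r` are separated from `r` by a single function. -/
theorem exists_farBelow_between {ι : Type} (hι : #ι < boundingNumber) (f : ι → ℕ → ℕ) (r : ℕ → ℕ)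
    (hf : ∀ i, FarBelow (f i) r) (hr : Tendsto r atTop atTop) :
    ∃ x : ℕ → ℕ, Tendsto x atTop atTop ∧ FarBelow x r ∧ ∀ i, FarBelow (f i) x := by
  obtain ⟨g, hg, hle⟩ := exists_tendsto_atTop_le hι (fun i n => r n - f i n) hf
  -- Halving leaves an unbounded gap on both sides; the minimum with `r n` keeps `x` itself
  -- unbounded.
  have hg' : Tendsto (fun n => min (g n) (r n) / 2) atTop atTop := by
    refine tendsto_atTop.2 fun k => ?_
    filter_upwards [hg.eventually_ge_atTop (2 * k), hr.eventually_ge_atTop (2 * k)] with n h1 h2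
    omega
  refine ⟨fun n => r n - min (g n) (r n) / 2, ?_, ?_, fun i => ?_⟩
  · exact tendsto_atTop_mono (fun n => by omega) hg'
  · exact tendsto_atTop_mono (fun n => by dsimp only; omega) hg'
  · refine tendsto_atTop_mono' atTop ?_ hg'
    filter_upwards [hle i] with n hn
    omega

/-- Every ordinal of cardinality at most `𝔟` embeds into the functions below the identity. -/
theorem exists_farBelow_chain (γ : Ordinal.{0}) (hγ : γ.card ≤ boundingNumber) :
    ∃ φ : γ.ToType → ℕ → ℕ, (∀ i, Tendsto (φ i) atTop atTop ∧ FarBelow (φ i) id) ∧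
      ∀ i j, i < j → FarBelow (φ i) (φ j) := by
  obtain ⟨e⟩ : #γ.ToType ≤ #boundingNumber.ord.ToType := by
    rwa [mk_ord_toType, mk_toType]
  obtain ⟨u, hu⟩ := exists_forall_rel_of_wellFounded (X := ℕ → ℕ)
    (r := fun j i => e j < e i) (InvImage.wf e wellFounded_lt)
    (fun i u x => Tendsto x atTop atTop ∧ FarBelow x id ∧ ∀ j, e j < e i →
      (j < i → FarBelow (u j) x) ∧ (i < j → FarBelow x (u j)))
    (fun i u v x huv hx => ⟨hx.1, hx.2.1, fun j hj => huv j hj ▸ hx.2.2 j hj⟩)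
    (by
      intro i u ih
      have hpair : ∀ j k, e j < e i → e k < e i → j < k → FarBelow (u j) (u k) := by
        intro j k hj hk hjk
        rcases lt_trichotomy (e j) (e k) with h | h | h
        · exact ((ih k hk).2.2 j h).1 hjk
        · exact absurd (e.injective h) hjk.ne
        · exact ((ih j hj).2.2 k h).2 hjk
      -- Since `γ` is well ordered, the earlier functions required above the new one have a least
      -- member `r` (or `r = id`), so only a family against one function has to be separated.
      obtain ⟨r, hr, hrid, hL, hR⟩ : ∃ r : ℕ → ℕ, Tendsto r atTop atTop ∧
          (r = id ∨ FarBelow r id) ∧ (∀ j, e j < e i → j < i → FarBelow (u j) r) ∧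
          ∀ j, e j < e i → i < j → r = u j ∨ FarBelow r (u j) := by
        by_cases hne : {j | e j < e i ∧ i < j}.Nonempty
        · obtain ⟨m, hm, hmin⟩ := wellFounded_lt.has_min _ hne
          refine ⟨u m, (ih m hm.1).1, .inr (ih m hm.1).2.1,
            fun j hj hji => hpair j m hj hm.1 (hji.trans hm.2), fun j hj hij => ?_⟩
          rcases (not_lt.1 (hmin j ⟨hj, hij⟩)).eq_or_lt with h | h
          · exact .inl (h ▸ rfl)
          · exact .inr (hpair m j hm.1 hj h)
        · exact ⟨id, tendsto_id, .inl rfl, fun j hj _ => (ih j hj).2.1,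
            fun j hj hij => absurd ⟨j, hj, hij⟩ hne⟩
      have hcard : #{j // e j < e i ∧ j < i} < boundingNumber := by
        refine lt_of_le_of_lt ?_ ((mk_Iio_lt (e i) (by simp)).trans_eq (mk_ord_toType _))
        exact ⟨⟨fun j => ⟨e j.1, j.2.1⟩, fun a b h =>
          Subtype.ext (e.injective (congrArg Subtype.val h))⟩⟩
      obtain ⟨x, hx, hxr, hxL⟩ := exists_farBelow_between hcard (fun j => u j.1) r
        (fun j => hL j.1 j.2.1 j.2.2) hr
      refine ⟨x, hx, ?_, fun j hj => ⟨fun h => hxL ⟨j, hj, h⟩, fun h => ?_⟩⟩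
      · rcases hrid with rfl | h
        · exact hxr
        · exact hxr.trans h
      · rcases hR j hj h with rfl | h
        · exact hxr
        · exact hxr.trans h)
  refine ⟨u, fun i => ⟨(hu i).1, (hu i).2.1⟩, fun i j hij => ?_⟩
  rcases lt_trichotomy (e i) (e j) with h | h | h
  · exact ((hu j).2.2 i h).1 hij
  · exact absurd (e.injective h) hij.ne
  · exact ((hu i).2.2 j h).2 hij

/-! ### Self-maps of ultrafilters and strict RK-comparison -/

/-- If `u` contains the preimages under `g` of its elements, then `g` is the identity on an
element of `u`. -/
theorem Ultrafilter.eventually_eq_self_of_preimage_mem (u : Ultrafilter ℕ) (g : ℕ → ℕ)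
    (hg : ∀ s ∈ u, g ⁻¹' s ∈ u) : ∀ᶠ n in u, g n = n := by
  -- A 2-colouring that `g` flips on `D` keeps `D` out of `u`: `u` picks one colour, and its
  -- preimage under `g` must also be in `u`.
  have hcolor : ∀ (D : Set ℕ) (c : ℕ → Prop), (∀ n ∈ D, c n ↔ ¬ c (g n)) → D ∉ u := by
    intro D c hc hD
    rcases u.em c with h | h
    · obtain ⟨n, ⟨h1, h2⟩, h3⟩ := u.nonempty_of_mem (inter_mem (inter_mem h (hg _ h)) hD)
      exact (hc n h3).1 h1 h2
    · obtain ⟨n, ⟨h1, h2⟩, h3⟩ := u.nonempty_of_mem (inter_mem (inter_mem h (hg _ h)) hD)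
      exact h1 ((hc n h3).2 h2)
  have hlt : {n | g n < n} ∉ u := by
    obtain ⟨c, hc⟩ := exists_forall_rel_of_wellFounded (X := Prop) (r := fun j i : ℕ => j < i)
      wellFounded_lt (fun i c x => g i < i → (x ↔ ¬ c (g i)))
      (fun i u v x huv hx hi => by rw [← huv _ hi]; exact hx hi)
      (fun i c _ => ⟨¬ c (g i), fun _ => Iff.rfl⟩)
    exact hcolor _ c hc
  have hgt : {n | n < g n} ∉ u := by
    -- Where `g` increases, recursion runs downwards from a bound `N`; the colourings are then
    -- merged by a limit along a free ultrafilter in `N`.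
    have hN : ∀ N : ℕ, ∃ c : ℕ → Prop, ∀ i, i < g i ∧ g i ≤ N → (c i ↔ ¬ c (g i)) := fun N =>
      exists_forall_rel_of_wellFounded (X := Prop) (r := fun j i : ℕ => N - j < N - i)
        (InvImage.wf (fun i => N - i) wellFounded_lt)
        (fun i c x => i < g i ∧ g i ≤ N → (x ↔ ¬ c (g i)))
        (fun i u v x huv hx hi => by rw [← huv _ (by omega)]; exact hx hi)
        (fun i c _ => ⟨¬ c (g i), fun _ => Iff.rfl⟩)
    choose c hc using hN
    let w : Ultrafilter ℕ := hyperfilter ℕ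
    have hw : ∀ k, ∀ᶠ N in (w : Filter ℕ), k ≤ N := fun k =>
      (hyperfilter_le_cofinite (α := ℕ)) (Nat.cofinite_eq_atTop ▸ eventually_ge_atTop k)
    refine hcolor _ (fun n => ∀ᶠ N in (w : Filter ℕ), c N n) fun n hn => ?_
    rw [← Ultrafilter.eventually_not]
    refine eventually_congr ?_
    filter_upwards [hw (g n)] with N hN
    exact hc N n ⟨hn, hN⟩
  have h1 := Ultrafilter.compl_mem_iff_notMem.2 hlt
  have h2 := Ultrafilter.compl_mem_iff_notMem.2 hgt
  filter_upwards [h1, h2] with n h1 h2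
  simp only [Set.mem_compl_iff, Set.mem_ofPred_eq] at h1 h2
  omega

/-- If `f` factors through `f'` modulo `q`, but `f'` factors through `f` on no element of `q`, then
the image of `q` under `f` is strictly below the image under `f'`. -/
theorem rklt_map_map (q : Ultrafilter ℕ) (f f' π : ℕ → ℕ) (hπ : ∀ᶠ x in q, π (f' x) = f x)
    (hinj : ∀ A ∈ q, ∃ x ∈ A, ∃ y ∈ A, f x = f y ∧ f' x ≠ f' y) :
    RKLT (q.map f : Filter ℕ) (q.map f' : Filter ℕ) := by
  have hpre : ∀ s ∈ q.map f, π ⁻¹' s ∈ q.map f' := by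
    intro s hs
    rw [Ultrafilter.mem_map] at hs ⊢
    filter_upwards [hs, hπ] with x hx hx'
    simpa [hx'] using hx
  refine ⟨⟨π, hpre⟩, ?_⟩
  rintro ⟨h, hh⟩
  have hfix := Ultrafilter.eventually_eq_self_of_preimage_mem (q.map f') (fun y => h (π y))
    fun s hs => hpre _ (hh s hs)
  have hA : {x | h (f x) = f' x} ∈ q := by
    have hfix' : ∀ᶠ x in q, h (π (f' x)) = f' x := hfix
    filter_upwards [hfix', hπ] with x hx hx'
    simpa [hx'] using hx
  obtain ⟨x, hx, y, hy, hxy, hne⟩ := hinj _ hA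
  exact hne (by rw [← hx, ← hy, hxy])

/-- A free image of a P-point is a P-point. -/
theorem IsPPoint.map {q : Ultrafilter ℕ} (hq : IsPPoint q) (f : ℕ → ℕ)
    (hf : (q.map f : Filter ℕ) ≤ cofinite) : IsPPoint (q.map f) := by
  refine ⟨hf, fun V hV hcov => ?_⟩
  obtain ⟨U, hU, h⟩ := hq.2 (fun n => f ⁻¹' V n) (fun i j hij => (hV hij).preimage f)
    (by rw [← Set.preimage_iUnion, hcov, Set.preimage_univ])
  refine ⟨f '' U, image_mem_map hU, h.imp ?_ fun h n => ?_⟩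
  · rintro ⟨n, hn⟩
    exact ⟨n, Set.image_subset_iff.2 hn⟩
  · rw [← Set.image_inter_preimage]
    exact (h n).image f

/-! ### Large sets and the construction of `q` -/

/-- `A` meets the sets `B n` in sets whose size, measured in units of `s n`, tends to infinity
along `p`. -/
def IsLargeAlong (p : Ultrafilter ℕ) (B : ℕ → Set ℕ) (s : ℕ → ℕ) (A : Set ℕ) : Prop :=
  ∀ k, ∀ᶠ n in p, k * s n ≤ (A ∩ B n).ncard

section IsLargeAlong

variable {p : Ultrafilter ℕ} {B : ℕ → Set ℕ} {s : ℕ → ℕ}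

theorem IsLargeAlong.mono (hB : ∀ n, (B n).Finite) {A A' : Set ℕ} (h : IsLargeAlong p B s A)
    (hAA' : A ⊆ A') : IsLargeAlong p B s A' := fun k => by
  filter_upwards [h k] with n hn
  exact hn.trans (Set.ncard_le_ncard (Set.inter_subset_inter_left _ hAA')
    ((hB n).subset Set.inter_subset_right))

/-- If the two sets fail with factors `k` and `l`, both fail at a common `n`, as `p` is an
ultrafilter, and the union fails with factor `k + l`. -/
theorem IsLargeAlong.or_of_union {A A' : Set ℕ} (h : IsLargeAlong p B s (A ∪ A')) :
    IsLargeAlong p B s A ∨ IsLargeAlong p B s A' := by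
  by_contra! hcon
  simp only [IsLargeAlong, not_forall, ← Ultrafilter.eventually_not, not_le] at hcon
  obtain ⟨⟨k, hk⟩, l, hl⟩ := hcon
  obtain ⟨n, ⟨h1, h2⟩, h3⟩ := p.nonempty_of_mem (inter_mem (inter_mem hk hl) (h (k + l)))
  simp only [Set.mem_ofPred_eq] at h1 h2 h3
  have := Set.ncard_union_le (A ∩ B n) (A' ∩ B n)
  rw [← Set.union_inter_distrib_right] at this
  rw [add_mul] at h3
  omega

theorem IsLargeAlong.infinite (hs : ∀ᶠ n in p, 0 < s n) {A : Set ℕ} (h : IsLargeAlong p B s A) :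
    A.Infinite := by
  intro hfin
  obtain ⟨n, h1, h2⟩ := p.nonempty_of_mem (inter_mem hs (h (A.ncard + 1)))
  simp only [Set.mem_ofPred_eq] at h1 h2
  have h3 := Set.ncard_le_ncard (Set.inter_subset_left (s := A) (t := B n)) hfin
  have h4 := Nat.le_mul_of_pos_right (A.ncard + 1) h1
  omega

/-- A function tending to infinity along a P-point does so on an element of it. -/
theorem IsPPoint.exists_mem_tendsto (hp : IsPPoint p) (h : ℕ → ℕ) (hh : ∀ k, ∀ᶠ n in p, k ≤ h n) :
    ∃ S ∈ p, ∀ k, {n ∈ S | h n < k}.Finite := by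
  obtain ⟨S, hS, hS'⟩ := hp.2 (fun k => h ⁻¹' {k})
    (fun i j hij => (Set.disjoint_singleton.2 hij).preimage h)
    (Set.eq_univ_of_forall fun n => Set.mem_iUnion.2 ⟨h n, rfl⟩)
  refine ⟨S, hS, fun k => ?_⟩
  rcases hS' with ⟨m, hm⟩ | hfin
  · obtain ⟨n, h1, h2⟩ := p.nonempty_of_mem (inter_mem hS (hh (m + 1)))
    have h3 : h n = m := hm h1
    have h4 : m + 1 ≤ h n := h2
    omega
  · refine ((Set.finite_Iio k).biUnion fun j _ => hfin j).subset ?_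
    rintro n ⟨h1, h2⟩
    exact Set.mem_biUnion (x := h n) h2 ⟨h1, rfl⟩

/-- A filter base of fewer than `𝔟` large sets can be refined by a set that is contained in one of
the sets `V n` or almost disjoint from all of them. -/
theorem exists_refinement_isLargeAlong (hp : IsPPoint p) (hB : ∀ n, (B n).Finite)
    {κ : Type} (hκ : #κ < boundingNumber) (A : κ → Set ℕ)
    (hdir : ∀ F G, ∃ H, A H ⊆ A F ∩ A G) (hA : ∀ F, IsLargeAlong p B s (A F)) (V : ℕ → Set ℕ) :
    ∃ U : Set ℕ, ((∃ n, U ⊆ V n) ∨ ∀ n, (U ∩ V n).Finite) ∧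
      ∀ F, IsLargeAlong p B s (U ∩ A F) := by
  classical
  by_cases hcase : ∃ n, ∀ F, IsLargeAlong p B s (V n ∩ A F)
  · obtain ⟨n, hn⟩ := hcase
    exact ⟨V n, .inl ⟨n, subset_rfl⟩, hn⟩
  push Not at hcase
  choose G hG using hcase
  let W : ℕ → Set ℕ := fun k => {x | ∀ i < k, x ∉ V i}
  have hWanti : ∀ {k l}, k ≤ l → W l ⊆ W k := fun hkl x hx i hi => hx i (hi.trans_le hkl)
  have hAW : ∀ k F, IsLargeAlong p B s (A F ∩ W k) := by
    intro k
    induction k with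
    | zero => exact fun F => (hA F).mono hB fun x hx => ⟨hx, fun i hi => absurd hi (by omega)⟩
    | succ k ih =>
      intro F
      obtain ⟨H, hH⟩ := hdir F (G k)
      have hsub : A H ∩ W k ⊆ (A F ∩ W (k + 1)) ∪ (V k ∩ A (G k)) := by
        rintro x ⟨hx, hxW⟩
        by_cases hxV : x ∈ V k
        · exact .inr ⟨hxV, (hH hx).2⟩
        · refine .inl ⟨(hH hx).1, fun i hi => ?_⟩
          rcases Nat.lt_succ_iff_lt_or_eq.1 hi with h | rfl
          · exact hxW i h
          · exact hxV
      exact (((ih H).mono hB hsub).or_of_union).resolve_right (hG k)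
  -- `h F n` is how many of the `V i` can be removed from `A F` in block `n` while keeping a
  -- comparably large remainder; a single `g` below all the `h F` is then used for removal.
  let P : κ → ℕ → ℕ → Prop := fun F n k => k * s n ≤ (A F ∩ W k ∩ B n).ncard
  let h : κ → ℕ → ℕ := fun F n => Nat.findGreatest (P F n) n
  have hP : ∀ F n, P F n (h F n) := fun F n =>
    Nat.findGreatest_spec (P := P F n) (Nat.zero_le n) (by simp [P])
  have hge : ∀ k, ∀ᶠ n in p, k ≤ n := fun k =>
    hp.1 (Nat.cofinite_eq_atTop ▸ eventually_ge_atTop k)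
  have hh : ∀ F k, ∀ᶠ n in p, k ≤ h F n := by
    intro F k
    filter_upwards [hAW k F k, hge k] with n h1 h2
    exact Nat.le_findGreatest h2 h1
  choose S hS hSfin using fun F => hp.exists_mem_tendsto (h F) (hh F)
  -- Outside `S F` the value `n` is a filler that makes the function tend to infinity everywhere.
  obtain ⟨g, hg, hgle⟩ := exists_tendsto_atTop_le hκ (fun F n => if n ∈ S F then h F n else n)
    (by
      intro F
      refine tendsto_atTop.2 fun k => ?_
      have h1 := (hSfin F k).compl_mem_cofinite
      rw [Nat.cofinite_eq_atTop] at h1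
      filter_upwards [h1, eventually_ge_atTop k] with n h1 h2
      split_ifs with h3
      · exact not_lt.1 fun h4 => h1 ⟨h3, h4⟩
      · exact h2)
  refine ⟨⋃ n, B n ∩ W (g n), .inr fun j => ?_, fun F k => ?_⟩
  · have h1 : {n | g n ≤ j}.Finite := by
      have := hg.eventually_gt_atTop j
      rw [← Nat.cofinite_eq_atTop, eventually_cofinite] at this
      simpa using this
    refine (h1.biUnion fun n _ => hB n).subset ?_
    rintro x ⟨hx, hxV⟩
    obtain ⟨n, hxB, hxW⟩ := Set.mem_iUnion.1 hx
    exact Set.mem_biUnion (x := n) (not_lt.1 fun hlt => hxW j hlt hxV) hxB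
  · filter_upwards [hS F, hp.1 (Nat.cofinite_eq_atTop ▸ hgle F), hh F k] with n h1 h2 h3
    rw [if_pos h1] at h2
    refine ((Nat.mul_le_mul_right _ h3).trans (hP F n)).trans
      (Set.ncard_le_ncard ?_ ((hB n).subset Set.inter_subset_right))
    rintro x ⟨⟨hxA, hxW⟩, hxB⟩
    exact ⟨⟨Set.mem_iUnion.2 ⟨n, hxB, hWanti h2 hxW⟩, hxA⟩, hxB⟩

/-- Under `𝔟 = 𝔠` there is a P-point all of whose elements are large along a given P-point. -/
theorem exists_isPPoint_forall_isLargeAlong (hbc : boundingNumber = Cardinal.continuum)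
    (hp : IsPPoint p) (hB : ∀ n, (B n).Finite) (hs : ∀ᶠ n in p, 0 < s n)
    (huniv : IsLargeAlong p B s Set.univ) :
    ∃ q : Ultrafilter ℕ, IsPPoint q ∧ ∀ A ∈ q, IsLargeAlong p B s A := by
  classical
  obtain ⟨e⟩ : #(ℕ → Set ℕ) ≤ #boundingNumber.ord.ToType := by
    rw [mk_ord_toType, hbc]
    simp
  have hfin : ∀ (u : (ℕ → Set ℕ) → Set ℕ) (F : Finset (ℕ → Set ℕ)),
      (∀ i ∈ F, ∀ G : Finset (ℕ → Set ℕ), (∀ j ∈ G, e j < e i) →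
        IsLargeAlong p B s (u i ∩ ⋂ j ∈ G, u j)) → IsLargeAlong p B s (⋂ j ∈ F, u j) := by
    intro u F hF
    rcases F.eq_empty_or_nonempty with rfl | hne
    · simpa using huniv
    · obtain ⟨m, hm, hmax⟩ := F.exists_max_image e hne
      refine (hF m hm (F.erase m) fun j hj => ?_).mono hB ?_
      · obtain ⟨h1, h2⟩ := Finset.mem_erase.1 hj
        exact (hmax j h2).lt_of_ne fun h => h1 (e.injective h)
      · rintro x ⟨hx, hx'⟩
        refine Set.mem_iInter₂.2 fun j hj => ?_
        by_cases hjm : j = m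
        · rwa [hjm]
        · exact Set.mem_iInter₂.1 hx' j (Finset.mem_erase.2 ⟨hjm, hj⟩)
  obtain ⟨u, hu⟩ := exists_forall_rel_of_wellFounded (X := Set ℕ)
    (r := fun j i => e j < e i) (InvImage.wf e wellFounded_lt)
    (fun i u x => ((∃ n, x ⊆ i n) ∨ ∀ n, (x ∩ i n).Finite) ∧
      ∀ G : Finset (ℕ → Set ℕ), (∀ j ∈ G, e j < e i) → IsLargeAlong p B s (x ∩ ⋂ j ∈ G, u j))
    (fun i u v x huv hx => ⟨hx.1, fun G hG => by
      rw [← Set.iInter₂_congr fun j hj => huv j (hG j hj)]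
      exact hx.2 G hG⟩)
    (by
      intro i u ih
      have hcard : #(Finset {j // e j < e i}) < boundingNumber := by
        have h1 : #{j // e j < e i} < boundingNumber := by
          refine lt_of_le_of_lt ?_ ((mk_Iio_lt (e i) (by simp)).trans_eq (mk_ord_toType _))
          exact ⟨⟨fun j => ⟨e j.1, j.2⟩, fun a b h =>
            Subtype.ext (e.injective (congrArg Subtype.val h))⟩⟩
        rcases finite_or_infinite {j // e j < e i} with h | h
        · exact ((lt_aleph0_of_finite _).trans aleph0_lt_continuum).trans_eq hbc.symm
        · rwa [mk_finset_of_infinite]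
      obtain ⟨U, hU, hUA⟩ := exists_refinement_isLargeAlong (s := s) hp hB hcard
        (fun F => ⋂ j ∈ F.map (Function.Embedding.subtype _), u j)
        (fun F G => ⟨F ∪ G, fun x hx => by
          simp only [Finset.map_union, Finset.mem_union, Set.mem_iInter, Set.mem_inter_iff] at hx ⊢
          exact ⟨fun j hj => hx j (.inl hj), fun j hj => hx j (.inr hj)⟩⟩)
        (fun F => hfin u _ fun j hj => by
          obtain ⟨j, -, rfl⟩ := Finset.mem_map.1 hj
          exact (ih j.1 j.2).2) i
      refine ⟨U, hU, fun G hG => ?_⟩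
      have := hUA (G.subtype _)
      rwa [Finset.subtype_map_of_mem hG] at this)
  have hlarge : ∀ F : Finset (ℕ → Set ℕ), IsLargeAlong p B s (⋂ j ∈ F, u j) := fun F =>
    hfin u F fun i _ => (hu i).2
  have hne : (⨅ F : Finset (ℕ → Set ℕ), 𝓟 (⋂ j ∈ F, u j)).NeBot := by
    refine iInf_neBot_of_directed (fun F G => ⟨F ∪ G, ?_, ?_⟩) fun F => ?_
    · exact principal_mono.2 (Set.biInter_mono (fun j hj => Finset.mem_union_left _ hj)
        fun _ _ => subset_rfl)
    · exact principal_mono.2 (Set.biInter_mono (fun j hj => Finset.mem_union_right _ hj)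
        fun _ _ => subset_rfl)
    · exact principal_neBot_iff.2 ((hlarge F).infinite hs).nonempty
  obtain ⟨q, hq⟩ := Ultrafilter.exists_le (⨅ F : Finset (ℕ → Set ℕ), 𝓟 (⋂ j ∈ F, u j))
  have hmem : ∀ i, u i ∈ q := fun i =>
    hq (mem_iInf_of_mem {i} (by simp))
  have hular : ∀ i, IsLargeAlong p B s (u i) := fun i => by simpa using hlarge {i}
  have hql : ∀ A ∈ q, IsLargeAlong p B s A := by
    intro A hA
    -- The recursion treats all sequences of sets, so this one forces `u V` to decide `A`; the
    -- almost disjoint alternative would make `u V` finite.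
    let V : ℕ → Set ℕ := fun n => if n = 0 then A else Aᶜ
    rcases (hu V).1 with ⟨n, hn⟩ | h
    · by_cases h0 : n = 0
      · exact (hular V).mono hB (by simpa [V, h0] using hn)
      · have : Aᶜ ∈ q := mem_of_superset (hmem V) (by simpa [V, h0] using hn)
        exact absurd hA (Ultrafilter.compl_mem_iff_notMem.1 this)
    · refine absurd (((h 0).union (h 1)).subset fun x hx => ?_) ((hular V).infinite hs)
      by_cases hxA : x ∈ A
      · exact .inl ⟨hx, by simpa [V] using hxA⟩
      · exact .inr ⟨hx, by simpa [V] using hxA⟩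
  refine ⟨q, ⟨fun t ht => ?_, fun V _ _ => ⟨u V, hmem V, (hu V).1⟩⟩, hql⟩
  by_contra htq
  exact (hql _ (Ultrafilter.compl_mem_iff_notMem.2 htq)).infinite hs ht

end IsLargeAlong

/-! ### Power blocks and truncations -/

/-- The codes of pairs `(n, x)` with `x < n ^ n`. -/
def powBlock (n : ℕ) : Set ℕ := Nat.pair n '' Set.Iio (n ^ n)

/-- Reduction of the second component of a pair `(n, x)` modulo `n ^ φ n`. -/
def truncate (φ : ℕ → ℕ) (z : ℕ) : ℕ :=
  Nat.pair z.unpair.1 (z.unpair.2 % z.unpair.1 ^ φ z.unpair.1)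

theorem powBlock_finite (n : ℕ) : (powBlock n).Finite := (Set.finite_Iio _).image _

theorem ncard_powBlock (n : ℕ) : (powBlock n).ncard = n ^ n := by
  rw [powBlock, Set.ncard_image_of_injective _ fun a b h => (Nat.pair_eq_pair.1 h).2]
  simp

theorem isLargeAlong_powBlock_univ {p : Ultrafilter ℕ} (hp : IsPPoint p) :
    IsLargeAlong p powBlock (fun n => n ^ (n - 1)) Set.univ := by
  intro k
  filter_upwards [hp.1 (Nat.cofinite_eq_atTop ▸ eventually_ge_atTop k),
    hp.1 (Nat.cofinite_eq_atTop ▸ eventually_gt_atTop 0)] with n h1 h2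
  rw [Set.univ_inter, ncard_powBlock]
  calc k * n ^ (n - 1) ≤ n * n ^ (n - 1) := Nat.mul_le_mul_right _ h1
    _ = n ^ n := mul_pow_sub_one h2.ne' n

/-- If on the subset `A` of a block the residues modulo `n ^ a` determine those modulo `n ^ b`,
where `a < b`, then `A` is small. -/
theorem ncard_inter_powBlock_le {n a b : ℕ} (hn : 0 < n) (hab : a < b) (hb : b ≤ n) (A : Set ℕ)
    (hA : ∀ x y, Nat.pair n x ∈ A → Nat.pair n y ∈ A → x % n ^ a = y % n ^ a →
      x % n ^ b = y % n ^ b) :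
    (A ∩ powBlock n).ncard ≤ n ^ (n - 1) := by
  -- A point of `A` is determined by its residue modulo `n ^ a` and its quotient by `n ^ b`; `a < b`
  -- makes the exponent `a + (n - b)` at most `n - 1`.
  let T : Finset (ℕ × ℕ) := Finset.range (n ^ a) ×ˢ Finset.range (n ^ (n - b))
  have hT : (T : Set (ℕ × ℕ)).ncard = n ^ (a + (n - b)) := by
    simp [T, pow_add]
  have hle : (A ∩ powBlock n).ncard ≤ (T : Set (ℕ × ℕ)).ncard := by
    refine Set.ncard_le_ncard_of_injOn
      (fun z => (z.unpair.2 % n ^ a, z.unpair.2 / n ^ b)) ?_ ?_ T.finite_toSet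
    · rintro _ ⟨-, x, hx, rfl⟩
      simp only [T, Nat.unpair_pair, Finset.coe_product, Finset.coe_range, Set.mem_prod,
        Set.mem_Iio] at hx ⊢
      refine ⟨Nat.mod_lt _ (by positivity), Nat.div_lt_of_lt_mul ?_⟩
      rwa [← pow_add, Nat.add_sub_cancel' hb]
    · rintro _ ⟨hxA, x, -, rfl⟩ _ ⟨hyA, y, -, rfl⟩ h
      simp only [Nat.unpair_pair, Prod.mk.injEq] at h
      rw [← Nat.div_add_mod x (n ^ b), ← Nat.div_add_mod y (n ^ b), h.2, hA x y hxA hyA h.1]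
  rw [hT] at hle
  exact hle.trans (Nat.pow_le_pow_right hn (by omega))

section truncate

variable {p q : Ultrafilter ℕ}

/-- A set in `q` meets block `n` for `p`-almost all `n`, so its first coordinates form a set in `p`.
-/
theorem map_unpair_fst_eq (hp : IsPPoint p)
    (hq : ∀ A ∈ q, IsLargeAlong p powBlock (fun n => n ^ (n - 1)) A) :
    q.map (fun z => z.unpair.1) = p := by
  symm
  refine Ultrafilter.eq_of_le fun t ht => ?_
  filter_upwards [hq _ ht 1, hp.1 (Nat.cofinite_eq_atTop ▸ eventually_gt_atTop 0)] with n h1 h2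
  have hpos : 0 < ((fun z : ℕ => z.unpair.1) ⁻¹' t ∩ powBlock n).ncard :=
    lt_of_lt_of_le (by positivity) h1
  obtain ⟨_, hz, x, -, rfl⟩ := Set.nonempty_of_ncard_ne_zero hpos.ne'
  simpa using hz

theorem exists_mem_mod_eq_mod_ne (hp : IsPPoint p)
    (hq : ∀ A ∈ q, IsLargeAlong p powBlock (fun n => n ^ (n - 1)) A) {φ ψ : ℕ → ℕ}
    (hφψ : ∀ᶠ n in atTop, φ n < ψ n) (hψ : ∀ᶠ n in atTop, ψ n ≤ n) {A : Set ℕ} (hA : A ∈ q) :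
    ∃ n x y, Nat.pair n x ∈ A ∧ Nat.pair n y ∈ A ∧ x % n ^ φ n = y % n ^ φ n ∧
      x % n ^ ψ n ≠ y % n ^ ψ n := by
  by_contra! hcon
  have hev : ∀ᶠ n in atTop, 0 < n ∧ φ n < ψ n ∧ ψ n ≤ n :=
    (eventually_gt_atTop 0).and (hφψ.and hψ)
  obtain ⟨n, h1, h2, h3, h4⟩ := p.nonempty_of_mem
    (inter_mem (hq A hA 2) (hp.1 (Nat.cofinite_eq_atTop ▸ hev)))
  have h5 := ncard_inter_powBlock_le h2 h3 h4 A (hcon n)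
  have h6 : 2 * n ^ (n - 1) ≤ (A ∩ powBlock n).ncard := h1
  have h7 : 0 < n ^ (n - 1) := by positivity
  omega

theorem rklt_map_truncate (hp : IsPPoint p)
    (hq : ∀ A ∈ q, IsLargeAlong p powBlock (fun n => n ^ (n - 1)) A) {φ ψ : ℕ → ℕ}
    (hφψ : ∀ᶠ n in atTop, φ n < ψ n) (hψ : ∀ᶠ n in atTop, ψ n ≤ n) :
    RKLT (q.map (truncate φ) : Filter ℕ) (q.map (truncate ψ) : Filter ℕ) := by
  refine rklt_map_map q _ _ (truncate φ) ?_ fun A hA => ?_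
  · have h1 : ∀ᶠ n in (q.map (fun z => z.unpair.1) : Filter ℕ), φ n < ψ n := by
      rw [map_unpair_fst_eq hp hq]
      exact hp.1 (Nat.cofinite_eq_atTop ▸ hφψ)
    have h2 : ∀ᶠ z in (q : Filter ℕ), φ z.unpair.1 < ψ z.unpair.1 := h1
    filter_upwards [h2] with z hz
    simp [truncate, Nat.mod_mod_of_dvd _ (pow_dvd_pow z.unpair.1 hz.le)]
  · obtain ⟨n, x, y, hx, hy, h1, h2⟩ := exists_mem_mod_eq_mod_ne hp hq hφψ hψ hA
    exact ⟨_, hx, _, hy, by simpa [truncate] using h1, by simpa [truncate] using h2⟩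

theorem rklt_self_map_truncate (hp : IsPPoint p)
    (hq : ∀ A ∈ q, IsLargeAlong p powBlock (fun n => n ^ (n - 1)) A) {ψ : ℕ → ℕ}
    (hpos : ∀ᶠ n in atTop, 0 < ψ n) (hψ : ∀ᶠ n in atTop, ψ n ≤ n) :
    RKLT (p : Filter ℕ) (q.map (truncate ψ) : Filter ℕ) := by
  rw [← map_unpair_fst_eq hp hq]
  refine rklt_map_map q _ _ (fun z => z.unpair.1) (.of_forall fun z => by simp [truncate])
    fun A hA => ?_
  -- Exponent `0` retains nothing of `x`, so it plays the role of the first projection.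
  obtain ⟨n, x, y, hx, hy, -, h2⟩ :=
    exists_mem_mod_eq_mod_ne (φ := fun _ => 0) hp hq hpos hψ hA
  exact ⟨_, hx, _, hy, by simp, by simpa [truncate] using h2⟩

/-- Truncation keeps the first coordinate, so freeness of the image is inherited from `p`. -/
theorem isPPoint_map_truncate (hp : IsPPoint p) (hqp : IsPPoint q)
    (hq : ∀ A ∈ q, IsLargeAlong p powBlock (fun n => n ^ (n - 1)) A) (φ : ℕ → ℕ) :
    IsPPoint (q.map (truncate φ)) := by
  refine hqp.map _ fun t ht => ?_
  have hfin : ((fun z : ℕ => z.unpair.1) '' tᶜ).Finite := Set.Finite.image _ ht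
  have h2 : ((fun z : ℕ => z.unpair.1) '' tᶜ)ᶜ ∈ q.map (fun z => z.unpair.1) := by
    rw [map_unpair_fst_eq hp hq]
    exact hp.1 hfin.compl_mem_cofinite
  rw [Ultrafilter.mem_map] at h2
  refine Ultrafilter.mem_map.2 (mem_of_superset h2 fun z hz => ?_)
  by_contra hzt
  exact hz ⟨truncate φ z, hzt, by simp [truncate]⟩

end truncate

theorem lemmaM0 (hbc : boundingNumber = Cardinal.continuum)
    (γ : Ordinal.{0}) (hγ : γ < (Order.succ boundingNumber).ord)
    (p : Ultrafilter ℕ) (hp : IsPPoint p) :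
    ∃ P : Ordinal.{0} → Ultrafilter ℕ,
      P 0 = p ∧
      (∀ α < γ, IsZeroOrSucc α → IsPPoint (P α)) ∧
      (∀ α β : Ordinal.{0}, α < β → β < γ → IsZeroOrSucc α → IsZeroOrSucc β →
        RKLT (P α : Filter ℕ) (P β : Filter ℕ)) := by
  classical
  obtain ⟨φ, hφ, hφlt⟩ := exists_farBelow_chain γ (Order.lt_succ_iff.1 (lt_ord.1 hγ))
  obtain ⟨q, hqp, hq⟩ := exists_isPPoint_forall_isLargeAlong (s := fun n => n ^ (n - 1)) hbc hp
    powBlock_finite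
    (by
      filter_upwards [hp.1 (Nat.cofinite_eq_atTop ▸ eventually_gt_atTop 0)] with n hn
      exact pow_pos hn _)
    (isLargeAlong_powBlock_univ hp)
  let Φ : Ordinal.{0} → ℕ → ℕ := fun α =>
    if h : α < γ then φ (Ordinal.ToType.mk ⟨α, h⟩) else 0
  refine ⟨fun α => if α = 0 then p else q.map (truncate (Φ α)), if_pos rfl, fun α _ _ => ?_,
    fun α β hαβ hβγ _ _ => ?_⟩
  · dsimp only
    split_ifs
    · exact hp
    · exact isPPoint_map_truncate hp hqp hq _
  · have hΦβ : Φ β = φ (Ordinal.ToType.mk ⟨β, hβγ⟩) := dif_pos hβγ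
    have hle : ∀ᶠ n in atTop, Φ β n ≤ n := by
      rw [hΦβ]
      exact (hφ _).2.eventually_lt.mono fun n hn => hn.le
    dsimp only
    rw [if_neg (zero_le.trans_lt hαβ).ne']
    split_ifs with h0
    · refine rklt_self_map_truncate hp hq ?_ hle
      rw [hΦβ]
      exact (hφ _).1.eventually_gt_atTop 0
    · refine rklt_map_truncate hp hq ?_ hle
      have hΦα : Φ α = φ (Ordinal.ToType.mk ⟨α, hαβ.trans hβγ⟩) := dif_pos (hαβ.trans hβγ)
      rw [hΦα, hΦβ]
      exact (hφlt _ _ (Ordinal.ToType.mk.lt_iff_lt.2 hαβ)).eventually_lt
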